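/- Let $\|A\|_p=\bigl(\mathrm{Tr}\,(A^*A)^{p/2}\bigr)^{1/p}$ for a complex square matrix $A$. Let $\Phi$ be the qubit depolarizing channel with real parameter $\lambda$, that is, a completely positive trace-preserving linear map on the complex $2\times 2$ matrices with $\Phi(I)=I$ and $\Phi(\sigma_i)=\lambda\sigma_i$ for the three Pauli matrices $\sigma_1,\sigma_2,\sigma_3$, and let $\nu_p(\Phi)=\sup_\rho\|\Phi(\rho)\|_p$, where the supremum runs over all $2\times2$ states $\rho$ (that is, $\rho\ge 0$, $\mathrm{Tr}\,\rho=1$). Let $X,Y$ be complex $K\times K$ matrices such that $M=\begin{pmatrix}X&Y\\Y^*&X\end{pmatrix}\ge 0$, and let $(I\otimes\Phi)(M)$ be the image of $M$, regarded as an operator on $\mathbb{C}^K\otimes\mathbb{C}^2$ whose $2\times2$ block structure comes from the factor $\mathbb{C}^2$. Then for all real $p\ge 1$, $$(I\otimes\Phi)(M)=\begin{pmatrix}X&\lambda Y\\ \lambda Y^*&X\end{pmatrix},\qquad \nu_p(\Phi)=\left[\left(\frac{1+\lambda}{2}\right)^p+\left(\frac{1-\lambda}{2}\right)^p\right]^{1/p},$$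 and $$\left\|\begin{pmatrix}X&\lambda Y\\ \lambda Y^*&X\end{pmatrix}\right\|_p\le 2\,\nu_p(\Phi)\,\|X\|_p .$$ -/

import Mathlib

open Matrix
open scoped ComplexOrder

noncomputable section

/-- The Schatten (noncommutative `l_p`) norm `‖A‖_p = (Tr (A* A)^(p/2))^(1/p)`, where the power of
the positive semidefinite matrix `A* A` is taken by functional calculus. -/
def schattenNorm {m : Type*} [Fintype m] [DecidableEq m] (p : ℝ) (A : Matrix m m ℂ) : ℝ :=
  ((cfc (fun x : ℝ => x ^ (p / 2)) (Aᴴ * A)).trace.re) ^ (1 / p)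

/-- States: positive semidefinite matrices of trace one. -/
def IsState {m : Type*} [Fintype m] (ρ : Matrix m m ℂ) : Prop :=
  ρ.PosSemidef ∧ ρ.trace = 1

/-- Linear maps on the `2 × 2` complex matrices. -/
abbrev QubitMap : Type :=
  Matrix (Fin 2) (Fin 2) ℂ →ₗ[ℂ] Matrix (Fin 2) (Fin 2) ℂ

/-- The maximal `l_p` norm `ν_p(Φ)` of the output states of `Φ`. -/
def maxOutputNorm (p : ℝ) (Φ : QubitMap) : ℝ :=
  sSup {r : ℝ | ∃ ρ : Matrix (Fin 2) (Fin 2) ℂ, IsState ρ ∧ r = schattenNorm p (Φ ρ)}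

/-- Regard `M` as an operator on `ℂ^n ⊗ ℂ^2`, the two blocks being labelled by the basis of `ℂ^2`,
so that `M = ∑ a b, E_{ab} ⊗ M_{ab}`. This is the `2 × 2` matrix `M_{ab}`. -/
def qubitPart {n : Type*} (M : Matrix (n ⊕ n) (n ⊕ n) ℂ) (a b : n) : Matrix (Fin 2) (Fin 2) ℂ :=
  !![M (Sum.inl a) (Sum.inl b), M (Sum.inl a) (Sum.inr b);
     M (Sum.inr a) (Sum.inl b), M (Sum.inr a) (Sum.inr b)]

/-- The half-noisy map `(I ⊗ Φ)(∑ a b, E_{ab} ⊗ M_{ab}) = ∑ a b, E_{ab} ⊗ Φ(M_{ab})`. -/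
def halfNoisy {n : Type*} (Φ : QubitMap) (M : Matrix (n ⊕ n) (n ⊕ n) ℂ) :
    Matrix (n ⊕ n) (n ⊕ n) ℂ :=
  Matrix.fromBlocks
    (Matrix.of fun a b => Φ (qubitPart M a b) 0 0) (Matrix.of fun a b => Φ (qubitPart M a b) 0 1)
    (Matrix.of fun a b => Φ (qubitPart M a b) 1 0) (Matrix.of fun a b => Φ (qubitPart M a b) 1 1)

/-- Qubit channels: completely positive trace-preserving maps on the `2 × 2` matrices. -/
structure IsQubitChannel (Φ : QubitMap) : Prop where
  trace_preserving : ∀ A : Matrix (Fin 2) (Fin 2) ℂ, (Φ A).trace = A.trace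
  completely_positive : ∀ (k : ℕ) (M : Matrix (Fin k ⊕ Fin k) (Fin k ⊕ Fin k) ℂ),
    M.PosSemidef → (halfNoisy Φ M).PosSemidef

/-- The three Pauli matrices. -/
def pauli : Fin 3 → Matrix (Fin 2) (Fin 2) ℂ :=
  ![!![0, 1; 1, 0], !![0, -Complex.I; Complex.I, 0], !![1, 0; 0, -1]]

/-- `Φ` is the depolarizing channel with parameter `lam`: a qubit channel whose matrix in the
basis `I, σ₁, σ₂, σ₃` is `diag(1, lam, lam, lam)`. -/
structure IsDepolarizingChannel (lam : ℝ) (Φ : QubitMap) : Prop where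
  isQubitChannel : IsQubitChannel Φ
  map_one : Φ 1 = 1
  map_pauli : ∀ i : Fin 3, Φ (pauli i) = (lam : ℂ) • pauli i

end

/-! Conjugation by the sign matrix `Z = diag(1, -1)` flips the off-diagonal blocks, so the noisy
matrix is `N = a₁ M + a₂ Z M Z` with `a₁, a₂ = (1 ± lam) / 2`. In an eigenbasis of `X`, with `D = X
⊕ X`, write `M = √D C √D`; the diagonal blocks of `C` are projections, so `C + Z C Z ≤ 2`. The
Lieb-Thirring type bound `sum_eigenvalues_rpow_le` gives `Tr N^p ≤ 2^(p-1) (a₁^p + a₂^p) Tr D^p`,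
and `Tr D^p = 2 Tr X^p`.

That bound is the three lines theorem for `F(z) = Tr N^(p(1-z)) ∑ j, a j^(pz) D^(pz/2) C j
D^(pz/2)`. With `T = Tr N^p`, one has `F(1/p) = T`, `|F| ≤ κ T` on `Re z = 0` and `|F| ≤ L = ∑ j, a
j^p Tr (C j D^p)` on `Re z = 1`. Hence `T ≤ (κ T)^(1-1/p) L^(1/p)`, which is solved for `T`.

The same bound with `D = 1`, `κ = 1` and the pair `ρ, 1 - ρ` computes `ν_p`; a pure state attains
it. -/

/-! ### Complex powers of nonnegative reals. -/

/-- The power `x ^ w` of a nonnegative real number, with `0 ^ w = 0` for every exponent `w`, so that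
it is an entire function of `w`. -/
noncomputable def supportPow (x : ℝ) (w : ℂ) : ℂ :=
  if x = 0 then 0 else Complex.exp (w * (Real.log x : ℂ))

@[fun_prop]
theorem differentiable_supportPow (x : ℝ) : Differentiable ℂ (supportPow x) := by
  unfold supportPow
  split_ifs <;> fun_prop

theorem norm_supportPow_le (x : ℝ) (w : ℂ) : ‖supportPow x w‖ ≤ Real.exp (|w.re| * |Real.log x|) := by
  unfold supportPow
  split_ifs
  · simpa using Real.exp_nonneg _
  · rw [Complex.norm_exp, Complex.re_mul_ofReal, ← abs_mul]
    exact Real.exp_le_exp.2 (le_abs_self _)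

/-- Imaginary exponents are excluded because the real power has `0 ^ 0 = 1`; for them only the
inequality `norm_supportPow_le_one` survives. -/
theorem norm_supportPow {x : ℝ} (hx : 0 ≤ x) {w : ℂ} (hw : w.re ≠ 0) :
    ‖supportPow x w‖ = x ^ w.re := by
  unfold supportPow
  split_ifs with h
  · simp [h, hw]
  · rw [Complex.norm_exp, Complex.re_mul_ofReal, Real.rpow_def_of_pos (lt_of_le_of_ne hx (Ne.symm h)),
      mul_comm]

theorem norm_supportPow_le_one (x : ℝ) {w : ℂ} (hw : w.re = 0) : ‖supportPow x w‖ ≤ 1 := by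
  simpa [hw] using norm_supportPow_le x w

theorem supportPow_ofReal {x : ℝ} (hx : 0 ≤ x) {r : ℝ} (hr : r ≠ 0) :
    supportPow x r = ((x ^ r : ℝ) : ℂ) := by
  unfold supportPow
  split_ifs with h
  · simp [h, hr]
  · rw [Real.rpow_def_of_pos (lt_of_le_of_ne hx (Ne.symm h))]
    push_cast
    rw [mul_comm]

theorem supportPow_sub_one_mul {x : ℝ} (hx : 0 ≤ x) {p : ℝ} (hp : p ≠ 0) :
    supportPow x ((p - 1 : ℝ) : ℂ) * x = ((x ^ p : ℝ) : ℂ) := by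
  unfold supportPow
  split_ifs with h
  · simp [h, hp]
  · have hx' := lt_of_le_of_ne hx (Ne.symm h)
    rw [← Complex.ofReal_mul, ← Complex.ofReal_exp, ← Complex.ofReal_mul, mul_comm (p - 1),
      ← Real.rpow_def_of_pos hx', Real.rpow_sub_one h, div_mul_cancel₀ _ h]

theorem star_supportPow (x : ℝ) (w : ℂ) : star (supportPow x w) = supportPow x (star w) := by
  unfold supportPow
  split_ifs
  · simp
  · simp [← Complex.exp_conj]

/-- The three lines bound in the form `T ≤ (κ T) ^ (1 - 1 / p) * L ^ (1 / p)` solved for `T`. -/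
theorem le_of_le_interp {T κ L p : ℝ} (hT : 0 ≤ T) (hκ : 0 ≤ κ) (hL : 0 ≤ L) (hp : 1 ≤ p)
    (h : T ≤ (κ * T) ^ (1 - 1 / p) * L ^ (1 / p)) : T ≤ κ ^ (p - 1) * L := by
  have hp0 : 0 < p := by linarith
  rcases hT.eq_or_lt with rfl | hT
  · positivity
  -- The `p`-th power of the hypothesis is `T ^ p ≤ (κ T) ^ (p - 1) * L`; then `T ^ (p - 1)`
  -- cancels.
  have h1 := Real.rpow_le_rpow hT.le h hp0.le
  rw [Real.mul_rpow (by positivity) (by positivity), ← Real.rpow_mul (by positivity),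
    ← Real.rpow_mul hL, Real.mul_rpow hκ hT.le] at h1
  have e1 : (1 - 1 / p) * p = p - 1 := by field_simp
  have e2 : 1 / p * p = 1 := by field_simp
  rw [e1, e2, Real.rpow_one] at h1
  have h2 : T ^ p = T ^ (p - 1) * T := by
    rw [Real.rpow_sub_one hT.ne', div_mul_cancel₀ _ hT.ne']
  rw [h2] at h1
  have h3 : 0 < T ^ (p - 1) := by positivity
  refine le_of_mul_le_mul_left ?_ h3
  linarith

/-! ### Cauchy-Schwarz for a positive semidefinite form. -/

section

variable {m : Type*} [Fintype m]

/-- Cauchy-Schwarz and the arithmetic-geometric mean inequality for the sesquilinear form of a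
positive semidefinite matrix. -/
theorem Matrix.PosSemidef.norm_conj_apply_le {C : Matrix m m ℂ} (hC : C.PosSemidef)
    (A B : Matrix m m ℂ) (k : m) :
    ‖(Aᴴ * C * B) k k‖ ≤ (((Aᴴ * C * A) k k).re + ((Bᴴ * C * B) k k).re) / 2 := by
  set w := (Aᴴ * C * B) k k with hw
  -- The phase `c` makes the cross term real, so positivity of the form at `A - c • B` bounds `2
  -- ‖w‖`.
  obtain ⟨c, hc, hcw⟩ : ∃ c : ℂ, ‖c‖ = 1 ∧ c * w = ‖w‖ := by
    rcases eq_or_ne w 0 with h | h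
    · exact ⟨1, by simp, by simp [h]⟩
    · refine ⟨(‖w‖ : ℂ) / w, ?_, div_mul_cancel₀ _ h⟩
      rw [norm_div, Complex.norm_real, norm_norm, div_self (norm_ne_zero_iff.2 h)]
  have h1 := (hC.conjTranspose_mul_mul_same (A - c • B)).diag_nonneg (i := k)
  have h2 : (Bᴴ * C * A) k k = star w := by
    have : Bᴴ * C * A = (Aᴴ * C * B)ᴴ := by
      simp [conjTranspose_mul, hC.isHermitian.eq, Matrix.mul_assoc]
    rw [this, conjTranspose_apply]
  have h3 : ((A - c • B)ᴴ * C * (A - c • B)) k k =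
      (Aᴴ * C * A) k k - c * w - star (c * w) + (star c * c) * (Bᴴ * C * B) k k := by
    simp only [conjTranspose_sub, conjTranspose_smul, Matrix.sub_mul, Matrix.mul_sub, smul_mul,
      Matrix.mul_smul, Matrix.sub_apply, Matrix.smul_apply, smul_eq_mul, h2, ← hw, star_mul']
    ring
  have h4 : star c * c = 1 := by
    rw [Complex.star_def, ← Complex.normSq_eq_conj_mul_self, Complex.normSq_eq_norm_sq, hc]; simp
  rw [h3, hcw, h4] at h1
  have := (Complex.le_def.1 h1).1
  simp at this
  linarith

variable [DecidableEq m]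

theorem conj_diagonal_apply (E C : Matrix m m ℂ) (s : m → ℂ) (k : m) :
    (Eᴴ * diagonal s * C * diagonal s * E) k k =
      ∑ l, (∑ i, star (E i k) * s i * C i l) * s l * E l k := by
  simp [Matrix.mul_apply, Matrix.diagonal_apply]

end

/-- The left diagonal factor is the adjoint of the power with conjugate exponent, so Cauchy-Schwarz
applies with exponents `star w` and `w`. -/
theorem norm_interpTerm_le {m : Type*} [Fintype m] [DecidableEq m]
    {E C : Matrix m m ℂ} {d : m → ℝ} (hC : C.PosSemidef) (w : ℂ)
    (k : m) :
    ‖(Eᴴ * diagonal (fun i => supportPow (d i) w) * C *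
      diagonal (fun i => supportPow (d i) w) * E) k k‖ ≤
    ((((diagonal (fun i => supportPow (d i) (star w)) * E)ᴴ * C *
        (diagonal (fun i => supportPow (d i) (star w)) * E)) k k).re +
      (((diagonal (fun i => supportPow (d i) w) * E)ᴴ * C *
        (diagonal (fun i => supportPow (d i) w) * E)) k k).re) / 2 := by
  have h := (hC).norm_conj_apply_le (diagonal (fun i => supportPow (d i) (star w)) * E)
    (diagonal (fun i => supportPow (d i) w) * E) k
  refine le_trans (le_of_eq ?_) h
  have : (diagonal fun i => supportPow (d i) (star w))ᴴ = diagonal fun i => supportPow (d i) w := by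
    rw [diagonal_conjTranspose]
    congr 1
    ext i
    simp [star_supportPow]
  rw [conjTranspose_mul, this]
  simp only [Matrix.mul_assoc]

/-! ### Three lines interpolation and the trace inequality. -/

section

variable {m ι : Type*} [Fintype m] [DecidableEq m] [Fintype ι]

/-- The analytic family interpolating between the powers of a positive semidefinite matrix with
eigenvalues `ν` and eigenvector matrix `E` and those of its summands `a j • √D * C j * √D`. -/
noncomputable def interpFamily (p : ℝ) (E : Matrix m m ℂ) (ν d : m → ℝ) (a : ι → ℝ)
    (C : ι → Matrix m m ℂ) (z : ℂ) : ℂ :=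
  ∑ k, supportPow (ν k) (p * (1 - z)) * ∑ j, supportPow (a j) (p * z) *
    (Eᴴ * diagonal (fun i => supportPow (d i) (p * z / 2)) * C j *
      diagonal (fun i => supportPow (d i) (p * z / 2)) * E) k k

theorem differentiable_interpFamily (p : ℝ) (E : Matrix m m ℂ) (ν d : m → ℝ) (a : ι → ℝ)
    (C : ι → Matrix m m ℂ) : Differentiable ℂ (interpFamily p E ν d a C) := by
  unfold interpFamily
  simp only [conj_diagonal_apply]
  fun_prop

/-- The exponent is affine with real coefficients, so its real part is bounded on the strip. This
supplies the boundedness needed for the three lines theorem. -/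
theorem isBigO_supportPow (x α β : ℝ) :
    (fun z : ℂ => supportPow x (α * z + β)) =O[Filter.principal
      (Complex.HadamardThreeLines.verticalClosedStrip 0 1)] (fun _ => (1 : ℝ)) := by
  refine Asymptotics.isBigO_principal.2 ⟨Real.exp ((|α| + |β|) * |Real.log x|), fun z hz => ?_⟩
  simp only [Complex.HadamardThreeLines.verticalClosedStrip, Set.mem_preimage, Set.mem_Icc] at hz
  refine (norm_supportPow_le _ _).trans ?_
  rw [norm_one, mul_one]
  gcongr
  simp only [Complex.add_re, Complex.re_ofReal_mul, Complex.ofReal_re]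
  refine (abs_add_le _ _).trans ?_
  refine add_le_add ?_ le_rfl
  rw [abs_mul, abs_of_nonneg hz.1]
  exact mul_le_of_le_one_right (abs_nonneg _) hz.2

theorem isBigO_interpFamily (p : ℝ) (E : Matrix m m ℂ) (ν d : m → ℝ) (a : ι → ℝ)
    (C : ι → Matrix m m ℂ) :
    interpFamily p E ν d a C =O[Filter.principal
      (Complex.HadamardThreeLines.verticalClosedStrip 0 1)] (fun _ => (1 : ℝ)) := by
  have hν : ∀ x : ℝ, (fun z : ℂ => supportPow x (p * (1 - z))) =O[Filter.principal
      (Complex.HadamardThreeLines.verticalClosedStrip 0 1)] (fun _ => (1 : ℝ)) := fun x => by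
    convert isBigO_supportPow x (-p) p using 3
    push_cast; ring
  have ha : ∀ x : ℝ, (fun z : ℂ => supportPow x (p * z)) =O[Filter.principal
      (Complex.HadamardThreeLines.verticalClosedStrip 0 1)] (fun _ => (1 : ℝ)) := fun x => by
    convert isBigO_supportPow x p 0 using 3
    push_cast; ring
  have hd : ∀ x : ℝ, (fun z : ℂ => supportPow x (p * z / 2)) =O[Filter.principal
      (Complex.HadamardThreeLines.verticalClosedStrip 0 1)] (fun _ => (1 : ℝ)) := fun x => by
    convert isBigO_supportPow x (p / 2) 0 using 3
    push_cast; ring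
  have hc : ∀ c : ℂ, (fun _ : ℂ => c) =O[Filter.principal
      (Complex.HadamardThreeLines.verticalClosedStrip 0 1)] (fun _ => (1 : ℝ)) :=
    fun c => Asymptotics.isBigO_const_const c one_ne_zero _
  have hmul : ∀ {f g : ℂ → ℂ}, f =O[Filter.principal
      (Complex.HadamardThreeLines.verticalClosedStrip 0 1)] (fun _ => (1 : ℝ)) →
      g =O[Filter.principal
      (Complex.HadamardThreeLines.verticalClosedStrip 0 1)] (fun _ => (1 : ℝ)) →
      (fun z => f z * g z) =O[Filter.principal
      (Complex.HadamardThreeLines.verticalClosedStrip 0 1)] (fun _ => (1 : ℝ)) :=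
    fun hf hg => by simpa using hf.mul hg
  unfold interpFamily
  simp only [conj_diagonal_apply]
  refine Asymptotics.IsBigO.fun_sum fun k _ => hmul (hν _) ?_
  refine Asymptotics.IsBigO.fun_sum fun j _ => hmul (ha _) ?_
  refine Asymptotics.IsBigO.fun_sum fun l _ => hmul (hmul ?_ (hd _)) (hc _)
  exact Asymptotics.IsBigO.fun_sum fun i _ => hmul (hmul (hc _) (hd _)) (hc _)

variable {E : Matrix m m ℂ} {ν d : m → ℝ} {a : ι → ℝ} {C : ι → Matrix m m ℂ} {p κ : ℝ}

/-- For an imaginary exponent the diagonal factor is a contraction, so each column of the product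
with `E` has norm at most one, and `∑ j, C j ≤ κ` is tested on it. -/
theorem sum_conj_apply_le_of_re_eq_zero (hE : Eᴴ * E = 1) (hκ : 0 ≤ κ)
    (hCκ : (κ • (1 : Matrix m m ℂ) - ∑ j, C j).PosSemidef) {w : ℂ} (hw : w.re = 0) (k : m) :
    ∑ j, (((diagonal (fun i => supportPow (d i) w) * E)ᴴ * C j *
        (diagonal (fun i => supportPow (d i) w) * E)) k k).re ≤ κ := by
  set B := diagonal (fun i => supportPow (d i) w) * E with hB
  have h := (hCκ.conjTranspose_mul_mul_same B).diag_nonneg (i := k)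
  simp only [Matrix.mul_sub, Matrix.sub_mul, Matrix.mul_sum, Matrix.sum_mul, Matrix.sub_apply,
    Matrix.sum_apply, Matrix.mul_smul, Matrix.smul_mul, Matrix.smul_apply, Matrix.mul_one] at h
  have h1 := (Complex.le_def.1 h).1
  simp only [Complex.zero_re, Complex.sub_re, Complex.re_sum, Complex.smul_re, smul_eq_mul] at h1
  have h2 : ((Bᴴ * B) k k).re ≤ ((Eᴴ * E) k k).re := by
    simp only [Matrix.mul_apply, conjTranspose_apply, Complex.re_sum]
    refine Finset.sum_le_sum fun i _ => ?_
    simp only [Complex.star_def, ← Complex.normSq_eq_conj_mul_self, Complex.ofReal_re, hB,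
      Matrix.diagonal_mul, Complex.normSq_mul]
    refine mul_le_of_le_one_left (Complex.normSq_nonneg _) ?_
    rw [Complex.normSq_eq_norm_sq]
    exact pow_le_one₀ (norm_nonneg _) (norm_supportPow_le_one _ hw)
  rw [hE, one_apply_eq, Complex.one_re] at h2
  nlinarith

/-- The sum over `k` is a trace, so the unitary `E` drops out by cyclicity and only the moduli of
the diagonal powers remain. -/
theorem sum_conj_apply_of_re_ne_zero (hE : E * Eᴴ = 1) (hd : ∀ i, 0 ≤ d i) {w : ℂ} (hw : w.re ≠ 0)
    (C : Matrix m m ℂ) :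
    ∑ k, (((diagonal (fun i => supportPow (d i) w) * E)ᴴ * C *
        (diagonal (fun i => supportPow (d i) w) * E)) k k).re =
      ∑ i, d i ^ (2 * w.re) * (C i i).re := by
  have h : ∑ k, ((diagonal (fun i => supportPow (d i) w) * E)ᴴ * C *
        (diagonal (fun i => supportPow (d i) w) * E)) k k =
      ((diagonal (fun i => supportPow (d i) w))ᴴ * C *
        diagonal (fun i => supportPow (d i) w)).trace := by
    change Matrix.trace _ = _
    rw [conjTranspose_mul, Matrix.mul_assoc, Matrix.mul_assoc, Matrix.trace_mul_comm,
      Matrix.mul_assoc, Matrix.mul_assoc, Matrix.mul_assoc, hE, Matrix.mul_one, Matrix.mul_assoc]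
  rw [← Complex.re_sum, h]
  simp only [Matrix.trace, diag_apply, diagonal_conjTranspose, Matrix.mul_diagonal,
    Matrix.diagonal_mul, Complex.re_sum]
  refine Finset.sum_congr rfl fun i _ => ?_
  rw [mul_right_comm, Pi.star_apply, Complex.star_def, ← Complex.normSq_eq_conj_mul_self,
    Complex.re_ofReal_mul, Complex.normSq_eq_norm_sq, norm_supportPow (hd i) hw,
    ← Real.rpow_natCast, ← Real.rpow_mul (hd i), mul_comm w.re]
  norm_cast

theorem norm_interpFamily_le_of_re_eq_zero (hp : 0 < p) (hE : Eᴴ * E = 1) (hν : ∀ k, 0 ≤ ν k)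
    (hκ : 0 ≤ κ) (hC : ∀ j, (C j).PosSemidef)
    (hCκ : (κ • (1 : Matrix m m ℂ) - ∑ j, C j).PosSemidef) {z : ℂ} (hz : z.re = 0) :
    ‖interpFamily p E ν d a C z‖ ≤ κ * ∑ k, ν k ^ p := by
  unfold interpFamily
  rw [Finset.mul_sum]
  refine (norm_sum_le _ _).trans (Finset.sum_le_sum fun k _ => ?_)
  have h1 : ((p : ℂ) * (1 - z)).re = p := by simp [hz]
  rw [norm_mul, norm_supportPow (hν k) (by rw [h1]; exact hp.ne'), h1, mul_comm]
  refine mul_le_mul_of_nonneg_right ?_ (Real.rpow_nonneg (hν k) p)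
  have hw : ((p : ℂ) * z / 2).re = 0 := by simp [hz]
  have hw' : (star ((p : ℂ) * z / 2)).re = 0 := by rw [Complex.star_def, Complex.conj_re, hw]
  refine (norm_sum_le _ _).trans ((Finset.sum_le_sum fun j _ => ?_).trans
    (?_ : ∑ j, ((((diagonal (fun i => supportPow (d i) (star ((p : ℂ) * z / 2))) * E)ᴴ * C j *
        (diagonal (fun i => supportPow (d i) (star ((p : ℂ) * z / 2))) * E)) k k).re +
      (((diagonal (fun i => supportPow (d i) ((p : ℂ) * z / 2)) * E)ᴴ * C j *
        (diagonal (fun i => supportPow (d i) ((p : ℂ) * z / 2)) * E)) k k).re) / 2 ≤ κ))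
  · rw [norm_mul]
    exact (mul_le_of_le_one_left (norm_nonneg _)
      (norm_supportPow_le_one _ (by simp [hz]))).trans (norm_interpTerm_le (hC j) _ k)
  · rw [← Finset.sum_div, Finset.sum_add_distrib]
    linarith [sum_conj_apply_le_of_re_eq_zero (d := d) hE hκ hCκ hw k,
      sum_conj_apply_le_of_re_eq_zero (d := d) hE hκ hCκ hw' k]

theorem norm_interpFamily_le_of_re_eq_one (hp : 0 < p) (hE : E * Eᴴ = 1) (hd : ∀ i, 0 ≤ d i)
    (ha : ∀ j, 0 ≤ a j) (hC : ∀ j, (C j).PosSemidef) {z : ℂ} (hz : z.re = 1) :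
    ‖interpFamily p E ν d a C z‖ ≤ ∑ j, a j ^ p * ∑ i, d i ^ p * (C j i i).re := by
  unfold interpFamily
  have hw : ((p : ℂ) * z / 2).re = p / 2 := by simp [hz]
  have hw' : (star ((p : ℂ) * z / 2)).re = p / 2 := by rw [Complex.star_def, Complex.conj_re, hw]
  have ha' : ((p : ℂ) * z).re = p := by simp [hz]
  refine (norm_sum_le _ _).trans ((Finset.sum_le_sum fun k _ => ?_).trans
    (?_ : ∑ k, ∑ j, a j ^ p *
      (((((diagonal (fun i => supportPow (d i) (star ((p : ℂ) * z / 2))) * E)ᴴ * C j *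
        (diagonal (fun i => supportPow (d i) (star ((p : ℂ) * z / 2))) * E)) k k).re +
      (((diagonal (fun i => supportPow (d i) ((p : ℂ) * z / 2)) * E)ᴴ * C j *
        (diagonal (fun i => supportPow (d i) ((p : ℂ) * z / 2)) * E)) k k).re) / 2) ≤ _))
  · rw [norm_mul]
    refine (mul_le_of_le_one_left (norm_nonneg _)
      (norm_supportPow_le_one _ (by simp [hz]))).trans ?_
    refine (norm_sum_le _ _).trans (Finset.sum_le_sum fun j _ => ?_)
    rw [norm_mul, norm_supportPow (ha j) (by rw [ha']; exact hp.ne'), ha']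
    exact mul_le_mul_of_nonneg_left (norm_interpTerm_le (hC j) _ k) (Real.rpow_nonneg (ha j) p)
  · rw [Finset.sum_comm]
    refine Finset.sum_le_sum fun j _ => ?_
    rw [← Finset.mul_sum, ← Finset.sum_div, Finset.sum_add_distrib,
      sum_conj_apply_of_re_ne_zero hE hd (by rw [hw']; positivity),
      sum_conj_apply_of_re_ne_zero hE hd (by rw [hw]; positivity), hw, hw',
      mul_div_cancel₀ p two_ne_zero, add_self_div_two]

/-- At `z = 1 / p` the exponents are `p - 1`, `1` and `1 / 2`, so the family is `Tr (N ^ (p - 1) *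
N)` in an eigenbasis of `N`. -/
theorem interpFamily_inv (hp : 0 < p) (hν : ∀ k, 0 ≤ ν k) (hd : ∀ i, 0 ≤ d i) (ha : ∀ j, 0 ≤ a j)
    (hN : Eᴴ * (∑ j, a j • (diagonal (fun i => ((√(d i) : ℝ) : ℂ)) * C j *
      diagonal (fun i => ((√(d i) : ℝ) : ℂ)))) * E = diagonal (fun k => (ν k : ℂ))) :
    interpFamily p E ν d a C ((1 / p : ℝ) : ℂ) = ((∑ k, ν k ^ p : ℝ) : ℂ) := by
  unfold interpFamily
  have hpc : (p : ℂ) ≠ 0 := by exact_mod_cast hp.ne'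
  have h1 : (p : ℂ) * ((1 / p : ℝ) : ℂ) = ((1 : ℝ) : ℂ) := by push_cast; field_simp
  have h2 : (p : ℂ) * (1 - ((1 / p : ℝ) : ℂ)) = ((p - 1 : ℝ) : ℂ) := by
    rw [mul_sub, h1]; push_cast; ring
  have h3 : ((1 : ℝ) : ℂ) / 2 = ((1 / 2 : ℝ) : ℂ) := by push_cast; rfl
  rw [h1, h2, h3]
  simp only [supportPow_ofReal (ha _) one_ne_zero, supportPow_ofReal (hd _)
    (show (1 / 2 : ℝ) ≠ 0 by norm_num), Real.rpow_one, ← Real.sqrt_eq_rpow]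
  push_cast
  refine Finset.sum_congr rfl fun k _ => ?_
  have h4 := congrFun (congrFun hN k) k
  rw [diagonal_apply_eq] at h4
  rw [← supportPow_sub_one_mul (hν k) hp.ne', ← h4]
  simp [Matrix.mul_sum, Matrix.sum_mul, Matrix.sum_apply, Matrix.mul_assoc]

/-- A trace inequality of Lieb-Thirring type. If the positive semidefinite matrix
`∑ j, a j • √D * C j * √D` has eigenvalues `ν`, where `∑ j, C j ≤ κ`, then the trace of its `p`-th
power is at most `κ ^ (p - 1) * ∑ j, a j ^ p * Tr (C j * D ^ p)`. -/
theorem sum_eigenvalues_rpow_le (hp : 1 ≤ p) (hE : E * Eᴴ = 1) (hν : ∀ k, 0 ≤ ν k)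
    (hd : ∀ i, 0 ≤ d i) (ha : ∀ j, 0 ≤ a j) (hκ : 0 ≤ κ) (hC : ∀ j, (C j).PosSemidef)
    (hCκ : (κ • (1 : Matrix m m ℂ) - ∑ j, C j).PosSemidef)
    (hN : Eᴴ * (∑ j, a j • (diagonal (fun i => ((√(d i) : ℝ) : ℂ)) * C j *
      diagonal (fun i => ((√(d i) : ℝ) : ℂ)))) * E = diagonal (fun k => (ν k : ℂ))) :
    ∑ k, ν k ^ p ≤ κ ^ (p - 1) * ∑ j, a j ^ p * ∑ i, d i ^ p * (C j i i).re := by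
  have hp0 : 0 < p := by linarith
  have hT : 0 ≤ ∑ k, ν k ^ p := Finset.sum_nonneg fun k _ => Real.rpow_nonneg (hν k) p
  have hL : 0 ≤ ∑ j, a j ^ p * ∑ i, d i ^ p * (C j i i).re :=
    Finset.sum_nonneg fun j _ => mul_nonneg (Real.rpow_nonneg (ha j) p) <|
      Finset.sum_nonneg fun i _ => mul_nonneg (Real.rpow_nonneg (hd i) p)
        (Complex.le_def.1 ((hC j).diag_nonneg (i := i))).1
  refine le_of_le_interp hT hκ hL hp ?_
  obtain ⟨B, hB⟩ := Asymptotics.isBigO_principal.1 (isBigO_interpFamily p E ν d a C)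
  have key := Complex.HadamardThreeLines.norm_le_interp_of_mem_verticalClosedStrip'
    (f := interpFamily p E ν d a C) (z := ((1 / p : ℝ) : ℂ)) (l := 0) (u := 1) one_pos
    (a := κ * ∑ k, ν k ^ p) (b := ∑ j, a j ^ p * ∑ i, d i ^ p * (C j i i).re)
    ⟨by rw [Complex.ofReal_re]; positivity,
      by rw [Complex.ofReal_re]; exact (div_le_one hp0).2 hp⟩
    (differentiable_interpFamily p E ν d a C).diffContOnCl
    ⟨B, by rintro _ ⟨z, hz, rfl⟩; simpa using hB z hz⟩
    (fun z hz => norm_interpFamily_le_of_re_eq_zero hp0 (mul_eq_one_comm.1 hE) hν hκ hC hCκ hz)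
    (fun z hz => norm_interpFamily_le_of_re_eq_one hp0 hE hd ha hC hz)
  rw [interpFamily_inv hp0 hν hd ha hN, Complex.norm_real, Real.norm_of_nonneg hT,
    Complex.ofReal_re, sub_zero, sub_zero, div_one] at key
  exact key

end

/-! ### Schatten norms through eigenvalues. -/

/-- The principal minor on `i, l` is nonnegative and equals `-|A i l|²`. -/
theorem Matrix.PosSemidef.apply_eq_zero_of_diag_eq_zero {m : Type*}
    {A : Matrix m m ℂ} (hA : A.PosSemidef)
    {i : m} (hi : A i i = 0) (l : m) : A i l = 0 := by
  have h := (hA.submatrix ![i, l]).det_nonneg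
  have h2 : A l i = star (A i l) := (hA.isHermitian.apply l i).symm
  rw [det_fin_two] at h
  simp only [submatrix_apply, cons_val_zero, cons_val_one, hi, h2, zero_mul, zero_sub,
    Complex.star_def, Complex.mul_conj] at h
  have h3 := (Complex.le_def.1 h).1
  simp only [Complex.zero_re, Complex.neg_re, Complex.ofReal_re] at h3
  exact Complex.normSq_eq_zero.1 (le_antisymm (by linarith) (Complex.normSq_nonneg _))

section

variable {m : Type*} [Fintype m] [DecidableEq m]

theorem eigenvectorUnitary_diagonalizes {A : Matrix m m ℂ} (hA : A.IsHermitian) :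
    (hA.eigenvectorUnitary : Matrix m m ℂ)ᴴ * A * (hA.eigenvectorUnitary : Matrix m m ℂ) =
      diagonal (fun i => (hA.eigenvalues i : ℂ)) := by
  have h := hA.conjStarAlgAut_star_eigenvectorUnitary
  rw [Unitary.conjStarAlgAut_star_apply] at h
  exact h

theorem schattenNorm_eq {A : Matrix m m ℂ} (hA : A.PosSemidef) (p : ℝ) :
    schattenNorm p A = (∑ i, hA.isHermitian.eigenvalues i ^ p) ^ (1 / p) := by
  have hsa : IsSelfAdjoint A := hA.isHermitian
  have hfin : ∀ f : ℝ → ℝ, ContinuousOn f (spectrum ℝ A) := fun f =>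
    (finite_real_spectrum (A := A)).continuousOn f
  have h1 : cfc (fun x : ℝ => x ^ (p / 2)) (Aᴴ * A) = cfc (fun x : ℝ => (x ^ 2) ^ (p / 2)) A := by
    rw [hA.isHermitian.eq, ← pow_two]
    refine (cfc_comp_pow (fun x : ℝ => x ^ (p / 2)) 2 A ?_ hsa).symm
    exact ((finite_real_spectrum (A := A)).image _).continuousOn _
  rw [schattenNorm, h1, hA.isHermitian.cfc_eq, IsHermitian.cfc, Unitary.conjStarAlgAut_apply,
    Matrix.trace_mul_comm, ← Matrix.mul_assoc, Unitary.coe_star_mul_self, Matrix.one_mul,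
    trace_diagonal, Complex.re_sum]
  congr 1
  refine Finset.sum_congr rfl fun i _ => ?_
  simp only [Function.comp_apply, Complex.coe_algebraMap, Complex.ofReal_re]
  rw [← Real.rpow_natCast, ← Real.rpow_mul (hA.eigenvalues_nonneg i)]
  congr 1
  push_cast
  ring

theorem schattenNorm_diagonal {d : m → ℝ} (hd : ∀ i, 0 ≤ d i) (p : ℝ) :
    schattenNorm p (diagonal (fun i => (d i : ℂ))) = (∑ i, d i ^ p) ^ (1 / p) := by
  have hA : (diagonal (fun i => (d i : ℂ))).PosSemidef :=
    PosSemidef.diagonal fun i => by simpa using hd i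
  rw [schattenNorm_eq hA]
  -- The eigenvalues come in no prescribed order, so they are matched with `d` as the multiset of
  -- roots of the characteristic polynomial.
  have h := hA.isHermitian.roots_charpoly_eq_eigenvalues
  rw [charpoly_diagonal, Polynomial.roots_prod _ _ (by
      simp [Finset.prod_ne_zero_iff, Polynomial.X_sub_C_ne_zero])] at h
  have h2 := congrArg (fun s => (s.map (fun c : ℂ => c.re ^ p)).sum) h
  simp only [Polynomial.roots_X_sub_C, Multiset.bind_singleton, Multiset.map_map] at h2
  congr 1
  exact h2.symm

/-- The trace inequality in a basis-free form: `D` is diagonal in the basis `V`, and `E = Vᴴ * U`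
passes from it to an eigenbasis `U` of `N`. -/
theorem schattenNorm_le {ι : Type*} [Fintype ι] {p κ : ℝ} {d : m → ℝ} {a : ι → ℝ}
    {C : ι → Matrix m m ℂ} {V N : Matrix m m ℂ} (hp : 1 ≤ p) (hNpos : N.PosSemidef)
    (hV : V * Vᴴ = 1) (hd : ∀ i, 0 ≤ d i) (ha : ∀ j, 0 ≤ a j) (hκ : 0 ≤ κ)
    (hC : ∀ j, (C j).PosSemidef) (hCκ : (κ • (1 : Matrix m m ℂ) - ∑ j, C j).PosSemidef)
    (hN : N = V * (∑ j, a j • (diagonal (fun i => ((√(d i) : ℝ) : ℂ)) * C j *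
      diagonal (fun i => ((√(d i) : ℝ) : ℂ)))) * Vᴴ) :
    schattenNorm p N ≤
      (κ ^ (p - 1) * ∑ j, a j ^ p * ∑ i, d i ^ p * (C j i i).re) ^ (1 / p) := by
  rw [schattenNorm_eq hNpos]
  set U : Matrix m m ℂ := (hNpos.isHermitian.eigenvectorUnitary : Matrix m m ℂ) with hU
  have hUU : U * Uᴴ = 1 := Unitary.coe_mul_star_self _
  refine Real.rpow_le_rpow (Finset.sum_nonneg fun k _ =>
    Real.rpow_nonneg (hNpos.eigenvalues_nonneg k) p) ?_ (by positivity)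
  refine sum_eigenvalues_rpow_le (E := Vᴴ * U) hp ?_ hNpos.eigenvalues_nonneg hd ha hκ hC hCκ ?_
  · rw [conjTranspose_mul, conjTranspose_conjTranspose, Matrix.mul_assoc, ← Matrix.mul_assoc U, hUU,
      Matrix.one_mul, mul_eq_one_comm.1 hV]
  · rw [← eigenvectorUnitary_diagonalizes hNpos.isHermitian, ← hU]
    conv_rhs => rw [hN]
    simp only [conjTranspose_mul, conjTranspose_conjTranspose, Matrix.mul_assoc]

end

/-! ### Block matrices with equal diagonal blocks. -/

theorem conjTranspose_diagonal_sign {n : Type*} [DecidableEq n] :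
    (diagonal (Sum.elim 1 (-1) : n ⊕ n → ℂ))ᴴ = diagonal (Sum.elim 1 (-1)) := by
  rw [diagonal_conjTranspose]
  congr 1
  ext (i | i) <;> simp

section

variable {n : Type*} [Fintype n] [DecidableEq n]

theorem fromBlocks_neg_offDiag (X Y Z W : Matrix n n ℂ) :
    diagonal (Sum.elim 1 (-1)) * fromBlocks X Y Z W * diagonal (Sum.elim 1 (-1)) =
      fromBlocks X (-Y) (-Z) W := by
  ext (i | i) (j | j) <;> simp

theorem fromBlocks_scaled_offDiag (lam : ℝ) (X Y Z W : Matrix n n ℂ) :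
    fromBlocks X ((lam : ℂ) • Y) ((lam : ℂ) • Z) W =
      ((1 + lam) / 2 : ℝ) • fromBlocks X Y Z W +
      ((1 - lam) / 2 : ℝ) • (diagonal (Sum.elim 1 (-1)) * fromBlocks X Y Z W *
        diagonal (Sum.elim 1 (-1))) := by
  rw [fromBlocks_neg_offDiag]
  ext (i | i) (j | j) <;> simp <;> ring

/-- Decreasing the off-diagonal blocks of a positive semidefinite block matrix with equal diagonal
blocks decreases the Schatten norms. -/
theorem schattenNorm_scaled_offDiag_le {lam p : ℝ} (h1 : 0 ≤ (1 + lam) / 2)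
    (h2 : 0 ≤ (1 - lam) / 2) (hp : 1 ≤ p) {X Y : Matrix n n ℂ}
    (hM : (fromBlocks X Y Yᴴ X).PosSemidef) :
    schattenNorm p (fromBlocks X ((lam : ℂ) • Y) ((lam : ℂ) • Yᴴ) X) ≤
      (((1 + lam) / 2) ^ p + ((1 - lam) / 2) ^ p) ^ (1 / p) * (2 * schattenNorm p X) := by
  have hp0 : 0 < p := by linarith
  have hX : X.PosSemidef := hM.submatrix Sum.inl
  set x := hX.isHermitian.eigenvalues with hx
  have hx0 : ∀ i, 0 ≤ x i := hX.eigenvalues_nonneg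
  set U : Matrix n n ℂ := (hX.isHermitian.eigenvectorUnitary : Matrix n n ℂ) with hU
  have hUU : U * Uᴴ = 1 := Unitary.coe_mul_star_self _
  have hUX : Uᴴ * X * U = diagonal (fun i => (x i : ℂ)) :=
    eigenvectorUnitary_diagonalizes hX.isHermitian
  set M := fromBlocks X Y Yᴴ X with hMdef
  set V : Matrix (n ⊕ n) (n ⊕ n) ℂ := fromBlocks U 0 0 U with hV
  set Z : Matrix (n ⊕ n) (n ⊕ n) ℂ := diagonal (Sum.elim 1 (-1)) with hZ
  have hZZ : Zᴴ = Z := conjTranspose_diagonal_sign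
  have hVV : V * Vᴴ = 1 := by
    simp [hV, fromBlocks_conjTranspose, fromBlocks_multiply, hUU, fromBlocks_one]
  set d : n ⊕ n → ℝ := Sum.elim x x with hd
  have hd0 : ∀ i, 0 ≤ d i := by rintro (i | i) <;> exact hx0 i
  set M' := Vᴴ * M * V with hM'
  have hM'pos : M'.PosSemidef := hM.conjTranspose_mul_mul_same V
  have hM'b : M' = fromBlocks (diagonal (fun i => (x i : ℂ))) (Uᴴ * Y * U) (Uᴴ * Yᴴ * U)
      (diagonal (fun i => (x i : ℂ))) := by
    simp [hM', hMdef, hV, fromBlocks_conjTranspose, fromBlocks_multiply, hUX]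
  have hM'd : ∀ i, M' i i = (d i : ℂ) := by
    rw [hM'b]; rintro (i | i) <;> simp [hd]
  set T : Matrix (n ⊕ n) (n ⊕ n) ℂ := diagonal (fun i => ((√(d i) : ℝ) : ℂ)) with hT
  -- Since `0⁻¹ = 0`, this is the pseudo-inverse of `T`, and singular `X` needs no limiting
  -- argument.
  set R : Matrix (n ⊕ n) (n ⊕ n) ℂ := diagonal (fun i => (((√(d i))⁻¹ : ℝ) : ℂ)) with hR
  have hRR : Rᴴ = R := by
    rw [hR, diagonal_conjTranspose]; congr 1; ext i; simp
  set C := R * M' * R with hC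
  have hCpos : C.PosSemidef := by
    have := hM'pos.conjTranspose_mul_mul_same R
    rwa [hRR] at this
  have hC2pos : (Z * C * Z).PosSemidef := by
    have := hCpos.conjTranspose_mul_mul_same Z
    rwa [hZZ] at this
  have hs : ∀ i, d i ≠ 0 → ((√(d i) : ℝ) : ℂ) ≠ 0 := fun i hi => by
    exact_mod_cast Real.sqrt_ne_zero'.2 (lt_of_le_of_ne (hd0 i) hi.symm)
  -- Nothing is lost off the support of `d`: a zero diagonal entry of `M'` kills its whole row and
  -- column.
  have hTCT : T * C * T = M' := by
    ext i l
    simp only [hC, hT, hR, Matrix.diagonal_mul, Matrix.mul_diagonal]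
    by_cases hi : d i = 0
    · rw [hM'pos.apply_eq_zero_of_diag_eq_zero (by rw [hM'd, hi]; simp) l]; simp
    by_cases hl : d l = 0
    · have : M' l i = 0 := hM'pos.apply_eq_zero_of_diag_eq_zero (by rw [hM'd, hl]; simp) i
      rw [← hM'pos.isHermitian.apply i l, this]; simp
    have := hs i hi
    have := hs l hl
    push_cast
    field_simp
  have hCd : ∀ i, C i i = if d i = 0 then 0 else 1 := fun i => by
    simp only [hC, hR, Matrix.diagonal_mul, Matrix.mul_diagonal, hM'd]
    split_ifs with hi
    · simp [hi]
    · rw [← Complex.ofReal_mul, ← Complex.ofReal_mul, ← Complex.ofReal_one]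
      congr 1
      rw [mul_right_comm, ← mul_inv, Real.mul_self_sqrt (hd0 i), inv_mul_cancel₀ hi]
  have hZd : ∀ i, (Z * C * Z) i i = C i i := by
    rintro (i | i) <;> simp [hZ]
  -- The off-diagonal blocks cancel, and the diagonal blocks of `M'` are already diagonal. The sum
  -- is twice the projection onto the support of `d`, whence `κ = 2`.
  have hsum : C + Z * C * Z = diagonal (fun i => 2 * C i i) := by
    ext (i | i) (l | l)
    · rcases eq_or_ne i l with rfl | h
      · simp [hZ]; ring
      · simp [hZ, hC, hR, hM'b, h]
    · simp [hZ]
    · simp [hZ]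
    · rcases eq_or_ne i l with rfl | h
      · simp [hZ]; ring
      · simp [hZ, hC, hR, hM'b, h]
  have hCκ : ((2 : ℝ) • (1 : Matrix (n ⊕ n) (n ⊕ n) ℂ) - ∑ j, ![C, Z * C * Z] j).PosSemidef := by
    rw [Fin.sum_univ_two]
    simp only [cons_val_zero, cons_val_one]
    have h2I : (2 : ℝ) • (1 : Matrix (n ⊕ n) (n ⊕ n) ℂ) = diagonal (fun _ => 2) := by
      ext i j
      rcases eq_or_ne i j with rfl | h <;> simp [*]
    rw [hsum, h2I, diagonal_sub]
    refine PosSemidef.diagonal fun i => ?_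
    simp only [hCd]
    split_ifs <;> simp
  have hTZ : T * Z = Z * T := by simp only [hT, hZ, diagonal_mul_diagonal, mul_comm]
  have hVZ : V * Z = Z * V := by
    ext (i | i) (l | l) <;> simp [hV, hZ]
  have hVZ' : Z * Vᴴ = Vᴴ * Z := by
    rw [← hZZ, ← conjTranspose_mul, hVZ, conjTranspose_mul, hZZ]
  have hVM : V * M' * Vᴴ = M := by
    rw [hM', Matrix.mul_assoc, Matrix.mul_assoc, Matrix.mul_assoc, hVV, Matrix.mul_one,
      ← Matrix.mul_assoc, hVV, Matrix.one_mul]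
  have hN : fromBlocks X ((lam : ℂ) • Y) ((lam : ℂ) • Yᴴ) X =
      V * (∑ j, ![(1 + lam) / 2, (1 - lam) / 2] j • (T * ![C, Z * C * Z] j * T)) * Vᴴ := by
    have e1 : T * (Z * C * Z) * T = Z * M' * Z := by
      rw [← hTCT]
      simp only [Matrix.mul_assoc]
      rw [← hTZ, ← Matrix.mul_assoc T Z, hTZ, Matrix.mul_assoc]
    have e2 : V * (Z * M' * Z) * Vᴴ = Z * M * Z := by
      rw [← hVM]
      simp only [Matrix.mul_assoc]
      rw [hVZ', ← Matrix.mul_assoc V Z, hVZ, Matrix.mul_assoc]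
    rw [Fin.sum_univ_two]
    simp only [cons_val_zero, cons_val_one]
    rw [hTCT, e1, Matrix.mul_add, Matrix.add_mul, Matrix.mul_smul, Matrix.mul_smul,
      Matrix.smul_mul, Matrix.smul_mul, hVM, e2, fromBlocks_scaled_offDiag]
  have hNpos : (fromBlocks X ((lam : ℂ) • Y) ((lam : ℂ) • Yᴴ) X).PosSemidef := by
    rw [fromBlocks_scaled_offDiag]
    have hM2 := hM.conjTranspose_mul_mul_same Z
    rw [hZZ] at hM2
    exact (hM.smul h1).add (hM2.smul h2)
  have key := schattenNorm_le (a := ![(1 + lam) / 2, (1 - lam) / 2]) (C := ![C, Z * C * Z])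
    hp hNpos hVV hd0 (by intro j; fin_cases j; exacts [h1, h2]) zero_le_two
    (by intro j; fin_cases j; exacts [hCpos, hC2pos]) hCκ hN
  refine key.trans (le_of_eq ?_)
  have hterm : ∑ i, d i ^ p * (C i i).re = 2 * ∑ i, x i ^ p := by
    have : ∀ i, d i ^ p * (C i i).re = d i ^ p := fun i => by
      rw [hCd]
      split_ifs with hi
      · simp [hi, hp0.ne']
      · simp
    rw [Finset.sum_congr rfl fun i _ => this i, Fintype.sum_sum_type]
    simp only [hd, Sum.elim_inl, Sum.elim_inr]
    ring
  rw [Fin.sum_univ_two]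
  simp only [cons_val_zero, cons_val_one, hZd, hterm]
  have hs0 : 0 ≤ ∑ i, x i ^ p := Finset.sum_nonneg fun i _ => Real.rpow_nonneg (hx0 i) p
  have hα := Real.rpow_nonneg h1 p
  have hβ := Real.rpow_nonneg h2 p
  -- The factor `κ ^ (p - 1) = 2 ^ (p - 1)` and the two copies of `x` in `d` combine to `2 ^ p`,
  -- whose root is the constant `2`.
  have h2p : ((2 : ℝ) ^ p) ^ (1 / p) = 2 := by
    rw [← Real.rpow_mul two_pos.le, mul_one_div_cancel hp0.ne', Real.rpow_one]
  have hfac : ∀ α β s : ℝ, (2 : ℝ) ^ (p - 1) * (α * (2 * s) + β * (2 * s)) =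
      (α + β) * (2 ^ p * s) := fun α β s => by
    rw [Real.rpow_sub_one two_ne_zero]
    ring
  rw [schattenNorm_eq hX, hfac, Real.mul_rpow (add_nonneg hα hβ) (by positivity),
    Real.mul_rpow (by positivity) hs0, h2p]

end

/-! ### The depolarizing channel and its maximal output norm. -/

/-- Follows by expanding `A` in the Pauli basis. On a state both summands are positive, which is the
shape that `schattenNorm_le` requires. -/
theorem IsDepolarizingChannel.apply_eq {lam : ℝ} {Φ : QubitMap} (hΦ : IsDepolarizingChannel lam Φ)
    (A : Matrix (Fin 2) (Fin 2) ℂ) :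
    Φ A = ((1 + lam) / 2 : ℝ) • A + ((1 - lam) / 2 : ℝ) • (A.trace • 1 - A) := by
  have hA : A = ((A 0 0 + A 1 1) / 2) • (1 : Matrix (Fin 2) (Fin 2) ℂ) +
      ((A 0 1 + A 1 0) / 2) • pauli 0 + (Complex.I * (A 0 1 - A 1 0) / 2) • pauli 1 +
      ((A 0 0 - A 1 1) / 2) • pauli 2 := by
    ext i j
    fin_cases i <;> fin_cases j <;> simp [pauli] <;> ring_nf <;> simp <;> ring
  have h := congrArg Φ hA
  simp only [map_add, map_smul, hΦ.map_one, hΦ.map_pauli] at h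
  rw [h]
  ext i j
  fin_cases i <;> fin_cases j <;> simp [pauli, trace_fin_two] <;> ring_nf <;> simp <;> ring

theorem IsDepolarizingChannel.apply_single {lam : ℝ} {Φ : QubitMap}
    (hΦ : IsDepolarizingChannel lam Φ) :
    Φ (diagonal ![1, 0]) = diagonal (fun i => ((![(1 + lam) / 2, (1 - lam) / 2] i : ℝ) : ℂ)) := by
  rw [hΦ.apply_eq]
  ext i j
  fin_cases i <;> fin_cases j <;> simp

/-- The two numbers are the eigenvalues of the image of a pure state, so positivity at `k = 1`
suffices. -/
theorem IsDepolarizingChannel.param_nonneg {lam : ℝ} {Φ : QubitMap}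
    (hΦ : IsDepolarizingChannel lam Φ) : 0 ≤ (1 + lam) / 2 ∧ 0 ≤ (1 - lam) / 2 := by
  have hpos : (diagonal (Sum.elim 1 0) : Matrix (Fin 1 ⊕ Fin 1) (Fin 1 ⊕ Fin 1) ℂ).PosSemidef :=
    PosSemidef.diagonal fun i => by rcases i with i | i <;> simp
  have h := hΦ.isQubitChannel.completely_positive 1 _ hpos
  have hq : qubitPart (diagonal (Sum.elim 1 0) : Matrix (Fin 1 ⊕ Fin 1) (Fin 1 ⊕ Fin 1) ℂ) 0 0 =
      diagonal ![1, 0] := by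
    ext i j
    fin_cases i <;> fin_cases j <;> simp [qubitPart]
  have h0 := h.diag_nonneg (i := Sum.inl 0)
  have h1 := h.diag_nonneg (i := Sum.inr 0)
  simp only [halfNoisy, fromBlocks_apply₁₁, fromBlocks_apply₂₂, of_apply, hq, hΦ.apply_single,
    diagonal_apply_eq, Complex.zero_le_real] at h0 h1
  exact ⟨h0, h1⟩

theorem IsDepolarizingChannel.halfNoisy_fromBlocks {lam : ℝ} {Φ : QubitMap}
    (hΦ : IsDepolarizingChannel lam Φ) {n : Type*} (X Y Z : Matrix n n ℂ) :
    halfNoisy Φ (fromBlocks X Y Z X) = fromBlocks X ((lam : ℂ) • Y) ((lam : ℂ) • Z) X := by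
  unfold halfNoisy
  simp only [hΦ.apply_eq]
  ext (i | i) (j | j) <;> simp [qubitPart, trace_fin_two] <;> ring

/-- For a `2 × 2` matrix of trace one, `1 - ρ` is the adjugate, which is the transpose conjugated by
a rotation through a right angle. -/
theorem IsState.one_sub_posSemidef {ρ : Matrix (Fin 2) (Fin 2) ℂ} (hρ : IsState ρ) :
    (1 - ρ).PosSemidef := by
  have h : 1 - ρ = (!![0, 1; -1, 0] : Matrix (Fin 2) (Fin 2) ℂ)ᴴ * ρᵀ * !![0, 1; -1, 0] := by
    have htr := hρ.2
    rw [trace_fin_two] at htr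
    ext i j
    fin_cases i <;> fin_cases j <;>
      simp [Matrix.mul_apply, Fin.sum_univ_two, conjTranspose_apply] <;> linear_combination -htr
  rw [h]
  exact hρ.1.transpose.conjTranspose_mul_mul_same _

theorem IsDepolarizingChannel.schattenNorm_apply_le {lam : ℝ} {Φ : QubitMap}
    (hΦ : IsDepolarizingChannel lam Φ) {p : ℝ} (hp : 1 ≤ p) {ρ : Matrix (Fin 2) (Fin 2) ℂ}
    (hρ : IsState ρ) :
    schattenNorm p (Φ ρ) ≤ (((1 + lam) / 2) ^ p + ((1 - lam) / 2) ^ p) ^ (1 / p) := by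
  obtain ⟨h1, h2⟩ := hΦ.param_nonneg
  have hρ' := hρ.one_sub_posSemidef
  have hΦρ : Φ ρ = ((1 + lam) / 2 : ℝ) • ρ + ((1 - lam) / 2 : ℝ) • (1 - ρ) := by
    rw [hΦ.apply_eq, hρ.2, one_smul]
  -- Here `κ = 1` because `ρ + (1 - ρ) = 1`, and each of the two summands has trace one.
  have key := schattenNorm_le (p := p) (κ := 1) (d := fun _ => 1) (V := 1)
    (a := ![(1 + lam) / 2, (1 - lam) / 2]) (C := ![ρ, 1 - ρ]) (N := Φ ρ) hp
    (hΦρ ▸ (hρ.1.smul h1).add (hρ'.smul h2)) (by simp) (fun _ => zero_le_one)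
    (by intro j; fin_cases j; exacts [h1, h2]) zero_le_one
    (by intro j; fin_cases j; exacts [hρ.1, hρ']) (by simp [PosSemidef.zero]) (by simp [hΦρ])
  refine key.trans (le_of_eq ?_)
  have htr := congrArg Complex.re hρ.2
  simp only [trace_fin_two, Complex.add_re, Complex.one_re] at htr
  simp only [Real.one_rpow, one_mul, Fin.sum_univ_two, cons_val_zero, cons_val_one,
    Matrix.sub_apply, one_apply_eq, Complex.sub_re, Complex.one_re]
  rw [htr, show 1 - (ρ 0 0).re + (1 - (ρ 1 1).re) = 1 by linarith, mul_one, mul_one]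

theorem IsDepolarizingChannel.maxOutputNorm_eq {lam : ℝ} {Φ : QubitMap}
    (hΦ : IsDepolarizingChannel lam Φ) {p : ℝ} (hp : 1 ≤ p) :
    maxOutputNorm p Φ = (((1 + lam) / 2) ^ p + ((1 - lam) / 2) ^ p) ^ (1 / p) := by
  obtain ⟨h1, h2⟩ := hΦ.param_nonneg
  refine IsGreatest.csSup_eq ⟨⟨diagonal ![1, 0], ⟨PosSemidef.diagonal fun i => ?_, ?_⟩, ?_⟩, ?_⟩
  · fin_cases i <;> simp
  · simp
  · rw [hΦ.apply_single, schattenNorm_diagonal (by intro j; fin_cases j; exacts [h1, h2]),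
      Fin.sum_univ_two]
    simp
  · rintro _ ⟨ρ, hρ, rfl⟩
    exact hΦ.schattenNorm_apply_le hp hρ

theorem mainTheorem7 {n : Type*} [Fintype n] [DecidableEq n]
    (lam : ℝ) (Φ : QubitMap) (hΦ : IsDepolarizingChannel lam Φ)
    (X Y : Matrix n n ℂ) (hM : (Matrix.fromBlocks X Y Yᴴ X).PosSemidef)
    (p : ℝ) (hp : 1 ≤ p) :
    halfNoisy Φ (Matrix.fromBlocks X Y Yᴴ X) =
        Matrix.fromBlocks X ((lam : ℂ) • Y) ((lam : ℂ) • Yᴴ) X ∧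
      maxOutputNorm p Φ = (((1 + lam) / 2) ^ p + ((1 - lam) / 2) ^ p) ^ (1 / p) ∧
      schattenNorm p (Matrix.fromBlocks X ((lam : ℂ) • Y) ((lam : ℂ) • Yᴴ) X) ≤
        maxOutputNorm p Φ * (2 * schattenNorm p X) := by
  obtain ⟨h1, h2⟩ := hΦ.param_nonneg
  refine ⟨hΦ.halfNoisy_fromBlocks X Y Yᴴ, hΦ.maxOutputNorm_eq hp, ?_⟩
  rw [hΦ.maxOutputNorm_eq hp]
  exact schattenNorm_scaled_offDiag_le h1 h2 hp hM
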